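/- Theorem 1 (Lieb–Robinson bound). Let $\Lambda$ be a finite set of sites with a metric $\mathrm{dist}$ (distinct sites at distance $0$ are allowed). Attach a Hilbert space $\mathbb{C}^D$ to each site, and let the whole system have Hilbert space $\bigotimes_{i\in\Lambda}\mathbb{C}^D$. An operator $O$ is supported on $A\subseteq\Lambda$ if $O=I_{\Lambda\setminus A}\otimes P$ for some operator $P$ on $\bigotimes_{i\in A}\mathbb{C}^D$. Let $\|\cdot\|$ denote the operator norm, and for nonempty $A,B\subseteq\Lambda$ put $\mathrm{dist}(A,B)=\min_{i\in A,\,j\in B}\mathrm{dist}(i,j)$, $\mathrm{dist}(i,B)=\mathrm{dist}(\{i\},B)$ and $\mathrm{diam}(A)=\max_{i,j\in A}\mathrm{dist}(i,j)$. Let $H=\sum_{Z\subseteq\Lambda}H_Z$ be a Hermitian operator, where each $H_Z$ is supported on $Z$, and let $O(t)=e^{iHt}Oe^{-iHt}$. Suppose that for some constants $\mu,s>0$ $$\sum_{X\ni i}\|H_X\|\,|X|\,e^{\mu\,\mathrm{diam}(X)}\le s\qquad\text{for every site } i\in\Lambda .$$ Let $A_X,B_Y$ be operators supported on nonempty sets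 $X,Y\subseteq\Lambda$ respectively, with $\mathrm{dist}(X,Y)>0$. Then for every real $t$, $$\|[A_X(t),B_Y]\|\le 2\|A_X\|\|B_Y\|\sum_{i\in X}e^{-\mu\,\mathrm{dist}(i,Y)}\left(e^{2s|t|}-1\right)\le 2\|A_X\|\|B_Y\|\,|X|\,e^{-\mu\,\mathrm{dist}(X,Y)}\left(e^{2s|t|}-1\right).$$ In particular the bounds do not depend on the local dimension $D$. -/

import Mathlib

open scoped Matrix.Norms.L2Operator

namespace LiebRobinson

/-- Basis configurations of a system of `D`-dimensional sites indexed by `S`: the product basis of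
`⨂_{i ∈ S} ℂ^D`. -/
abbrev Config (S : Type*) (D : ℕ) : Type _ := S → Fin D

/-- Operators on `⨂_{i ∈ S} ℂ^D`, written as matrices in the (orthonormal) product basis. The norm
of such a matrix is its operator norm with respect to the Euclidean norm of vectors. -/
abbrev Op (S : Type*) (D : ℕ) : Type _ := Matrix (Config S D) (Config S D) ℂ

section Support

variable {Λ : Type*} [Fintype Λ] [DecidableEq Λ] {D : ℕ}

/-- The operator `P ⊗ I_{Λ \ A}` on the whole system, where `P` is an operator on the sites in `A`.
The equivalence splits a configuration of `Λ` into its restrictions to `A` and to `Λ \ A`. -/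
def tensorId (A : Finset Λ) (P : Op {i : Λ // i ∈ A} D) : Op Λ D :=
  (Matrix.kronecker P (1 : Op {i : Λ // ¬ i ∈ A} D)).submatrix
    (Equiv.piEquivPiSubtypeProd (fun i : Λ => i ∈ A) (fun _ => Fin D))
    (Equiv.piEquivPiSubtypeProd (fun i : Λ => i ∈ A) (fun _ => Fin D))

/-- `O` is supported on the set of sites `A`. -/
def IsSupportedOn (O : Op Λ D) (A : Finset Λ) : Prop :=
  ∃ P : Op {i : Λ // i ∈ A} D, O = tensorId A P

/-- The Hamiltonian `∑_Z H_Z`, the sum being over all sets of sites. -/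
def hamiltonian (HZ : Finset Λ → Op Λ D) : Op Λ D := ∑ Z : Finset Λ, HZ Z

/-- Heisenberg evolution `O(t) = exp(i H t) O exp(-i H t)`. -/
noncomputable def heisenberg (H : Op Λ D) (t : ℝ) (O : Op Λ D) : Op Λ D :=
  NormedSpace.exp ((Complex.I * (t : ℂ)) • H) * O * NormedSpace.exp (-(Complex.I * (t : ℂ)) • H)

end Support

/-- The distance between two nonempty finite sets, `min_{i ∈ A, j ∈ B} dist(i, j)`. -/
noncomputable def setDist {Λ : Type*} [PseudoMetricSpace Λ] (A B : Finset Λ)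
    (hA : A.Nonempty) (hB : B.Nonempty) : ℝ :=
  (A ×ˢ B).inf' (hA.product hB) (fun p => dist p.1 p.2)

end LiebRobinson

/-! Let `K` collect the interaction terms disjoint from `X`. It commutes with `A`, so conjugation by
`exp(itK) exp(-itH)` sends the evolved `A` back to `A` and preserves norms. The growth of the
commutator with `B` is therefore driven only by the evolved `H - K`, the sum of the terms meeting
`X` (`norm_commutator_evolve_le`).

Each such term is again a local operator, so the estimate can be iterated. With the weight `w i =
exp(-μ dist(i, Y))`, the decay hypothesis closes the iteration (`sum_not_disjoint_weight_le`): the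
commutator is at most `2‖A‖‖B‖` times an indicator that `X` meets `Y` plus `(∑ i ∈ X, w i) * g`,
where `g` runs through Picard iterates of `g' = 2s(1 + g)`, `g 0 = 0`. These tend to `exp(2st) - 1`,
independently of `D`.

Only the total Hamiltonian is assumed Hermitian, so its terms are first replaced by their Hermitian
parts. -/

namespace LiebRobinson

/-! ### Unitary flows and the interaction picture. -/

section Dynamics

/-- The one-parameter group `exp(i t H)`. -/
noncomputable def unitaryFlow {𝔸 : Type*} [NormedRing 𝔸] [NormedAlgebra ℂ 𝔸] (H : 𝔸) (t : ℝ) : 𝔸 :=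
  NormedSpace.exp ((Complex.I * (t : ℂ)) • H)

/-- Heisenberg evolution in a Banach algebra. -/
noncomputable def evolve {𝔸 : Type*} [NormedRing 𝔸] [NormedAlgebra ℂ 𝔸] (H : 𝔸) (t : ℝ) (O : 𝔸) :
    𝔸 :=
  unitaryFlow H t * O * unitaryFlow H (-t)

theorem norm_commutator_le {R : Type*} [NormedRing R] (x y : R) : ‖⁅x, y⁆‖ ≤ 2 * ‖x‖ * ‖y‖ := by
  rw [Ring.lie_def]
  calc ‖x * y - y * x‖ ≤ ‖x * y‖ + ‖y * x‖ := norm_sub_le _ _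
    _ ≤ ‖x‖ * ‖y‖ + ‖y‖ * ‖x‖ := add_le_add (norm_mul_le _ _) (norm_mul_le _ _)
    _ = 2 * ‖x‖ * ‖y‖ := by ring

variable {𝔸 : Type*} [NormedRing 𝔸] [NormedAlgebra ℂ 𝔸]

theorem unitaryFlow_zero (H : 𝔸) : unitaryFlow H 0 = 1 := by
  simp [unitaryFlow, NormedSpace.exp_zero]

theorem commute_unitaryFlow {A K : 𝔸} (h : Commute A K) (t : ℝ) : Commute A (unitaryFlow K t) :=
  (h.smul_right _).exp_right

theorem evolve_sum {ι : Type*} (H : 𝔸) (t : ℝ) (s : Finset ι) (f : ι → 𝔸) :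
    evolve H t (∑ i ∈ s, f i) = ∑ i ∈ s, evolve H t (f i) := by
  simp only [evolve, Finset.mul_sum, Finset.sum_mul]

section Complete

variable [CompleteSpace 𝔸]

theorem unitaryFlow_add (H : 𝔸) (s t : ℝ) :
    unitaryFlow H (s + t) = unitaryFlow H s * unitaryFlow H t := by
  let : NormedAlgebra ℚ 𝔸 := NormedAlgebra.restrictScalars ℚ ℂ 𝔸
  rw [unitaryFlow, unitaryFlow, unitaryFlow, Complex.ofReal_add, mul_add, add_smul]
  exact NormedSpace.exp_add_of_commute (((Commute.refl H).smul_left _).smul_right _)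

theorem unitaryFlow_mul_neg (H : 𝔸) (t : ℝ) : unitaryFlow H t * unitaryFlow H (-t) = 1 := by
  rw [← unitaryFlow_add, add_neg_cancel, unitaryFlow_zero]

theorem unitaryFlow_neg_mul (H : 𝔸) (t : ℝ) : unitaryFlow H (-t) * unitaryFlow H t = 1 := by
  rw [← unitaryFlow_add, neg_add_cancel, unitaryFlow_zero]

theorem hasDerivAt_unitaryFlow (H : 𝔸) (t : ℝ) :
    HasDerivAt (unitaryFlow H) (unitaryFlow H t * (Complex.I • H)) t := by
  have h := hasDerivAt_exp_smul_const (𝕂 := ℝ) (Complex.I • H) t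
  have e : (fun u : ℝ => NormedSpace.exp (u • Complex.I • H)) = unitaryFlow H := by
    funext u
    rw [unitaryFlow, mul_comm, mul_smul, Complex.coe_smul]
  rw [e] at h
  convert h using 2
  exact (congrFun e t).symm

theorem hasDerivAt_unitaryFlow' (H : 𝔸) (t : ℝ) :
    HasDerivAt (unitaryFlow H) ((Complex.I • H) * unitaryFlow H t) t := by
  have h := hasDerivAt_unitaryFlow H t
  rwa [← (commute_unitaryFlow ((Commute.refl H).smul_left Complex.I) t).eq] at h

theorem hasDerivAt_unitaryFlow_neg (H : 𝔸) (t : ℝ) :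
    HasDerivAt (fun u => unitaryFlow H (-u)) (-((Complex.I • H) * unitaryFlow H (-t))) t := by
  have h := (hasDerivAt_unitaryFlow' H (-t)).scomp t (hasDerivAt_neg t)
  rw [neg_one_smul] at h
  exact h

/-- The interaction-picture conjugation `B ↦ W B W⁻¹`, `W = exp(itK) exp(-itH)`. -/
theorem hasDerivAt_interactionPicture (H K B : 𝔸) (t : ℝ) :
    HasDerivAt (fun u => unitaryFlow K u * unitaryFlow H (-u) * B *
        (unitaryFlow H u * unitaryFlow K (-u)))
      (-(Complex.I • (unitaryFlow K t * unitaryFlow H (-t) * ⁅evolve H t (H - K), B⁆ *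
        (unitaryFlow H t * unitaryFlow K (-t))))) t := by
  have h1 := (hasDerivAt_unitaryFlow K t).mul (hasDerivAt_unitaryFlow_neg H t)
  have h2 := (hasDerivAt_unitaryFlow H t).mul (hasDerivAt_unitaryFlow_neg K t)
  have h := (h1.mul_const B).mul h2
  refine h.congr_deriv ?_
  have e := unitaryFlow_neg_mul H t
  have key1 : unitaryFlow H (-t) * evolve H t (H - K) = (H - K) * unitaryFlow H (-t) := by
    rw [evolve, ← mul_assoc, ← mul_assoc, e, one_mul]
  have key2 : evolve H t (H - K) * unitaryFlow H t = unitaryFlow H t * (H - K) := by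
    rw [evolve, mul_assoc, e, mul_one]
  have expand : unitaryFlow K t * unitaryFlow H (-t) * ⁅evolve H t (H - K), B⁆ *
        (unitaryFlow H t * unitaryFlow K (-t)) =
      unitaryFlow K t * (unitaryFlow H (-t) * evolve H t (H - K)) * B *
        (unitaryFlow H t * unitaryFlow K (-t)) -
      unitaryFlow K t * unitaryFlow H (-t) * B *
        (evolve H t (H - K) * unitaryFlow H t) * unitaryFlow K (-t) := by
    rw [Ring.lie_def]; noncomm_ring
  rw [expand, key1, key2]
  simp only [Pi.mul_apply, mul_neg, neg_mul, sub_mul, mul_sub, add_mul, mul_add, smul_mul_assoc,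
    mul_smul_comm, smul_sub, mul_assoc]
  abel

end Complete

variable [StarRing 𝔸] [CStarRing 𝔸] [StarModule ℂ 𝔸]

theorem star_unitaryFlow {H : 𝔸} (hH : IsSelfAdjoint H) (t : ℝ) :
    star (unitaryFlow H t) = unitaryFlow H (-t) := by
  rw [unitaryFlow, unitaryFlow, NormedSpace.star_exp, star_smul, hH.star_eq]
  simp

variable [CompleteSpace 𝔸]

theorem unitaryFlow_mem_unitary {H : 𝔸} (hH : IsSelfAdjoint H) (t : ℝ) :
    unitaryFlow H t ∈ unitary 𝔸 := by
  rw [Unitary.mem_iff, star_unitaryFlow hH]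
  exact ⟨unitaryFlow_neg_mul H t, unitaryFlow_mul_neg H t⟩

theorem norm_evolve {H : 𝔸} (hH : IsSelfAdjoint H) (t : ℝ) (A : 𝔸) : ‖evolve H t A‖ = ‖A‖ := by
  rw [evolve, CStarRing.norm_mul_mem_unitary _ (unitaryFlow_mem_unitary hH _),
    CStarRing.norm_mem_unitary_mul _ (unitaryFlow_mem_unitary hH _)]

theorem norm_interactionPicture {H K : 𝔸} (hH : IsSelfAdjoint H) (hK : IsSelfAdjoint K) (t : ℝ)
    (B : 𝔸) :
    ‖unitaryFlow K t * unitaryFlow H (-t) * B * (unitaryFlow H t * unitaryFlow K (-t))‖ = ‖B‖ := by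
  rw [CStarRing.norm_mul_mem_unitary _ (mul_mem (unitaryFlow_mem_unitary hH _)
      (unitaryFlow_mem_unitary hK _)),
    CStarRing.norm_mem_unitary_mul _ (mul_mem (unitaryFlow_mem_unitary hK _)
      (unitaryFlow_mem_unitary hH _))]

/-- If `A` commutes with the part `K` of the Hamiltonian `H`, the growth of the commutator of the
evolved `A` with `B` is controlled by the commutator of the evolved `H - K` with `B`. -/
theorem norm_commutator_evolve_le {H K A B : 𝔸} (hH : IsSelfAdjoint H) (hK : IsSelfAdjoint K)
    (hAK : Commute A K) {β β' : ℝ → ℝ} (hβ : ∀ t, HasDerivAt β (β' t) t) (h0 : ‖⁅A, B⁆‖ ≤ β 0)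
    (hd : ∀ t, 0 ≤ t → 2 * ‖A‖ * ‖⁅evolve H t (H - K), B⁆‖ ≤ β' t) {t : ℝ} (ht : 0 ≤ t) :
    ‖⁅evolve H t A, B⁆‖ ≤ β t := by
  let G : ℝ → 𝔸 := fun u => unitaryFlow K u * unitaryFlow H (-u) * B *
        (unitaryFlow H u * unitaryFlow K (-u))
  let G' : ℝ → 𝔸 := fun u => -(Complex.I • (unitaryFlow K u * unitaryFlow H (-u) *
    ⁅evolve H u (H - K), B⁆ * (unitaryFlow H u * unitaryFlow K (-u))))
  have hG : ∀ u, HasDerivAt G (G' u) u := hasDerivAt_interactionPicture H K B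
  have hf : ∀ u, HasDerivAt (fun v => ⁅A, G v⁆) ⁅A, G' u⁆ u := fun u => by
    simp only [Ring.lie_def]
    exact ((hG u).const_mul A).sub ((hG u).mul_const A)
  have hG' : ∀ u, ‖G' u‖ = ‖⁅evolve H u (H - K), B⁆‖ := fun u => by
    simp only [G', norm_neg, norm_smul, Complex.norm_I, one_mul]
    exact norm_interactionPicture hH hK u _
  -- Conjugation by `exp(itK) exp(-itH)` turns `evolve H t A` into `exp(itK) A exp(-itK)`, which is
  -- `A` because `A` commutes with `K`.
  have hconj : ⁅A, G t⁆ = unitaryFlow K t * unitaryFlow H (-t) * ⁅evolve H t A, B⁆ *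
      (unitaryFlow H t * unitaryFlow K (-t)) := by
    have e := unitaryFlow_neg_mul H t
    have key1 : unitaryFlow K t * unitaryFlow H (-t) * evolve H t A =
        A * (unitaryFlow K t * unitaryFlow H (-t)) := by
      rw [evolve, ← mul_assoc, ← mul_assoc A, (commute_unitaryFlow hAK t).eq]
      simp only [mul_assoc]
      rw [← mul_assoc (unitaryFlow H (-t)) (unitaryFlow H t), e, one_mul]
    have key2 : evolve H t A * (unitaryFlow H t * unitaryFlow K (-t)) =
        unitaryFlow H t * unitaryFlow K (-t) * A := by
      rw [evolve, mul_assoc (unitaryFlow H t) (unitaryFlow K (-t)),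
        ← (commute_unitaryFlow hAK (-t)).eq]
      simp only [mul_assoc]
      rw [← mul_assoc (unitaryFlow H (-t)) (unitaryFlow H t), e, one_mul]
    have expand : unitaryFlow K t * unitaryFlow H (-t) * ⁅evolve H t A, B⁆ *
        (unitaryFlow H t * unitaryFlow K (-t)) =
        unitaryFlow K t * unitaryFlow H (-t) * evolve H t A * B *
          (unitaryFlow H t * unitaryFlow K (-t)) -
        unitaryFlow K t * unitaryFlow H (-t) * B *
          (evolve H t A * (unitaryFlow H t * unitaryFlow K (-t))) := by
      rw [Ring.lie_def]; noncomm_ring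
    rw [expand, key1, key2, Ring.lie_def]
    simp only [G, mul_assoc]
  have hnorm : ‖⁅evolve H t A, B⁆‖ = ‖⁅A, G t⁆‖ := by
    rw [hconj, norm_interactionPicture hH hK]
  rw [hnorm]
  -- Comparing derivatives with those of `β` replaces the usual integral inequality.
  refine image_norm_le_of_norm_deriv_right_le_deriv_boundary (f := fun v => ⁅A, G v⁆)
    (f' := fun u => ⁅A, G' u⁆) (a := 0) (b := t) (B := β) (B' := β')
    (fun u _ => (hf u).continuousAt.continuousWithinAt)
    (fun u _ => (hf u).hasDerivWithinAt) ?_ hβ (fun u hu => ?_) ⟨ht, le_rfl⟩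
  · simpa [G, unitaryFlow_zero] using h0
  · refine (norm_commutator_le _ _).trans ?_
    rw [hG']
    exact hd u hu.1

end Dynamics

/-! ### Operators supported on sets of sites. -/

section Locality

variable {Λ : Type*} [Fintype Λ] [DecidableEq Λ] {D : ℕ}

theorem tensorId_apply (A : Finset Λ) (P : Op {i : Λ // i ∈ A} D) (σ τ : Config Λ D) :
    tensorId A P σ τ = if ∀ i, i ∉ A → σ i = τ i then P (fun i => σ i) (fun i => τ i) else 0 := by
  simp only [tensorId, Matrix.submatrix_apply, Matrix.kronecker, Matrix.kroneckerMap_apply,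
    Matrix.one_apply, Equiv.piEquivPiSubtypeProd_apply, mul_ite, mul_one, mul_zero]
  exact if_congr (by simp [funext_iff]) rfl rfl

theorem tensorId_add (A : Finset Λ) (P Q : Op {i : Λ // i ∈ A} D) :
    tensorId A (P + Q) = tensorId A P + tensorId A Q := by
  ext σ τ
  simp only [Matrix.add_apply, tensorId_apply]
  split_ifs <;> simp

theorem tensorId_smul (A : Finset Λ) (c : ℂ) (P : Op {i : Λ // i ∈ A} D) :
    tensorId A (c • P) = c • tensorId A P := by
  ext σ τ
  simp only [Matrix.smul_apply, tensorId_apply]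
  split_ifs <;> simp

theorem tensorId_conjTranspose (A : Finset Λ) (P : Op {i : Λ // i ∈ A} D) :
    tensorId A P.conjTranspose = (tensorId A P).conjTranspose := by
  ext σ τ
  simp only [Matrix.conjTranspose_apply, tensorId_apply]
  rw [if_congr (Q := ∀ i, i ∉ A → τ i = σ i) (by simp only [eq_comm]) rfl rfl]
  split_ifs <;> simp

theorem IsSupportedOn.add {O O' : Op Λ D} {A : Finset Λ} (h : IsSupportedOn O A)
    (h' : IsSupportedOn O' A) : IsSupportedOn (O + O') A := by
  obtain ⟨P, rfl⟩ := h
  obtain ⟨Q, rfl⟩ := h'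
  exact ⟨P + Q, (tensorId_add A P Q).symm⟩

theorem IsSupportedOn.smul {O : Op Λ D} {A : Finset Λ} (c : ℂ) (h : IsSupportedOn O A) :
    IsSupportedOn (c • O) A := by
  obtain ⟨P, rfl⟩ := h
  exact ⟨c • P, (tensorId_smul A c P).symm⟩

theorem IsSupportedOn.conjTranspose {O : Op Λ D} {A : Finset Λ} (h : IsSupportedOn O A) :
    IsSupportedOn O.conjTranspose A := by
  obtain ⟨P, rfl⟩ := h
  exact ⟨P.conjTranspose, (tensorId_conjTranspose A P).symm⟩

theorem tensorId_mul_tensorId_apply {A B : Finset Λ} (h : Disjoint A B)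
    (P : Op {i : Λ // i ∈ A} D) (Q : Op {i : Λ // i ∈ B} D) (σ τ : Config Λ D) :
    (tensorId A P * tensorId B Q) σ τ =
      if ∀ i, i ∉ A → i ∉ B → σ i = τ i then
        P (fun i => σ i) (fun i => τ i) * Q (fun i => σ i) (fun i => τ i) else 0 := by
  -- The first factor fixes the intermediate configuration to be `σ` off `A`, the second to be `τ`
  -- off `B`, hence on `A`; only one survives.
  rw [Matrix.mul_apply, Finset.sum_eq_single (fun i => if i ∈ A then τ i else σ i)]
  · have hB : ∀ i ∈ B, i ∉ A := fun i hi hA => Finset.disjoint_left.1 h hA hi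
    rw [tensorId_apply, tensorId_apply, if_pos (fun i hi => by simp [hi])]
    have e1 : (fun i : {i // i ∈ A} => if (i : Λ) ∈ A then τ i else σ i) =
        fun i : {i // i ∈ A} => τ i := by
      funext i; simp
    have e2 : (fun i : {i // i ∈ B} => if (i : Λ) ∈ A then τ i else σ i) =
        fun i : {i // i ∈ B} => σ i := by
      funext i; simp [hB i i.2]
    rw [e1, e2, mul_ite, mul_zero]
    refine if_congr ⟨fun H i hA hB => ?_, fun H i hB => ?_⟩ rfl rfl
    · simpa [hA] using H i hB
    · by_cases hA : i ∈ A
      · simp [hA]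
      · simpa [hA] using H i hA hB
  · intro ρ _ hρ
    rw [tensorId_apply, tensorId_apply]
    by_cases h1 : ∀ i, i ∉ A → σ i = ρ i
    · by_cases h2 : ∀ i, i ∉ B → ρ i = τ i
      · refine absurd (funext fun i => ?_) hρ
        by_cases hA : i ∈ A
        · simp [hA, h2 i (Finset.disjoint_left.1 h hA)]
        · simp [hA, h1 i hA]
      · rw [if_neg h2, mul_zero]
    · rw [if_neg h1, zero_mul]
  · simp

theorem IsSupportedOn.commute {O O' : Op Λ D} {A B : Finset Λ} (hO : IsSupportedOn O A)
    (hO' : IsSupportedOn O' B) (h : Disjoint A B) : Commute O O' := by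
  obtain ⟨P, rfl⟩ := hO
  obtain ⟨Q, rfl⟩ := hO'
  refine Matrix.ext fun σ τ => ?_
  rw [tensorId_mul_tensorId_apply h, tensorId_mul_tensorId_apply h.symm, mul_comm (P _ _)]
  exact if_congr ⟨fun H i hB hA => H i hA hB, fun H i hA hB => H i hB hA⟩ rfl rfl

end Locality

/-! ### The scalar comparison functions. -/

section Growth

/-- The `n`-th Picard iterate for `g' = 2 s (1 + g)`, `g 0 = 0`, started from the constant `c`. -/
noncomputable def picardIterate (c s : ℝ) (n : ℕ) (t : ℝ) : ℝ :=
  ∑ k ∈ Finset.range n, (2 * s * t) ^ (k + 1) / (k + 1).factorial +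
    c * ((2 * s * t) ^ n / n.factorial)

theorem picardIterate_nonneg {c s t : ℝ} (hc : 0 ≤ c) (hs : 0 ≤ s) (ht : 0 ≤ t) (n : ℕ) :
    0 ≤ picardIterate c s n t := by
  unfold picardIterate
  positivity

theorem hasDerivAt_pow_succ_div_factorial (a : ℝ) (n : ℕ) (t : ℝ) :
    HasDerivAt (fun u : ℝ => (a * u) ^ (n + 1) / (n + 1).factorial)
      (a * ((a * t) ^ n / n.factorial)) t := by
  have h := ((((hasDerivAt_id t).const_mul a).pow (n + 1)).div_const ((n + 1).factorial : ℝ))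
  refine h.congr_deriv ?_
  have h1 : (n.factorial : ℝ) ≠ 0 := by positivity
  have h2 : ((n : ℝ) + 1) ≠ 0 := by positivity
  rw [Nat.factorial_succ]
  push_cast
  simp only [id]
  field_simp

theorem hasDerivAt_picardIterate_succ (c s : ℝ) (n : ℕ) (t : ℝ) :
    HasDerivAt (picardIterate c s (n + 1)) (2 * s * (1 + picardIterate c s n t)) t := by
  have h := (HasDerivAt.fun_sum (u := Finset.range (n + 1))
    fun k _ => hasDerivAt_pow_succ_div_factorial (2 * s) k t).add
      ((hasDerivAt_pow_succ_div_factorial (2 * s) n t).const_mul c)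
  refine h.congr_deriv ?_
  rw [← Finset.mul_sum, Finset.sum_range_succ', picardIterate]
  simp only [pow_zero, Nat.factorial_zero, Nat.cast_one, div_one]
  ring

theorem picardIterate_succ_zero (c s : ℝ) (n : ℕ) : picardIterate c s (n + 1) 0 = 0 := by
  simp [picardIterate]

/-- The first sum is a Taylor polynomial of the exponential without its constant term. -/
theorem picardIterate_le {c s t : ℝ} (hs : 0 ≤ s) (ht : 0 ≤ t) (n : ℕ) :
    picardIterate c s n t ≤
      Real.exp (2 * s * t) - 1 + c * ((2 * s * t) ^ n / n.factorial) := by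
  have h := Real.sum_le_exp_of_nonneg (x := 2 * s * t) (by positivity) (n + 1)
  rw [Finset.sum_range_succ'] at h
  simp only [pow_zero, Nat.factorial_zero, Nat.cast_one, div_one] at h
  unfold picardIterate
  linarith

end Growth

/-! ### Sums over interaction terms meeting a set. -/

section Combinatorics

variable {Λ : Type*} [Fintype Λ] [DecidableEq Λ]

/-- A union bound: each `Z` meeting `X` is counted at least once on the right. -/
theorem sum_not_disjoint_le (X : Finset Λ) {f : Finset Λ → ℝ} (hf : ∀ Z, 0 ≤ f Z) :
    ∑ Z : Finset Λ with ¬ Disjoint X Z, f Z ≤ ∑ i ∈ X, ∑ Z : Finset Λ with i ∈ Z, f Z := by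
  simp only [Finset.sum_filter]
  rw [Finset.sum_comm]
  refine Finset.sum_le_sum fun Z _ => ?_
  have hnn : ∀ i ∈ X, 0 ≤ if i ∈ Z then f Z else 0 := fun i _ => by split_ifs <;> simp [hf Z]
  split_ifs with h
  · exact Finset.sum_nonneg hnn
  · obtain ⟨i, hiX, hiZ⟩ := Finset.not_disjoint_iff.1 h
    refine le_trans ?_ (Finset.single_le_sum hnn hiX)
    simp [hiZ]

variable [PseudoMetricSpace Λ]

/-- One step of the Lieb–Robinson iteration, for a weight `w` that is at least `1` on `Y` and
varies at exponential rate at most `μ`. -/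
theorem sum_not_disjoint_weight_le {h : Finset Λ → ℝ} (hh : ∀ Z, 0 ≤ h Z) {μ s : ℝ} (hμ : 0 ≤ μ)
    (hdecay : ∀ i : Λ, ∑ Z : Finset Λ with i ∈ Z,
      h Z * (Z.card : ℝ) * Real.exp (μ * Metric.diam (Z : Set Λ)) ≤ s)
    {w : Λ → ℝ} (hw0 : ∀ i, 0 < w i) (hw : ∀ i j, w j ≤ Real.exp (μ * dist i j) * w i)
    {Y : Finset Λ} (hwY : ∀ j ∈ Y, 1 ≤ w j) {g : ℝ} (hg : 0 ≤ g) (X : Finset Λ) :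
    ∑ Z : Finset Λ with ¬ Disjoint X Z,
        h Z * ((if Disjoint Z Y then 0 else 1) + (∑ j ∈ Z, w j) * g) ≤
      s * (∑ i ∈ X, w i) * (1 + g) := by
  have hsum0 : ∀ Z : Finset Λ, 0 ≤ ∑ j ∈ Z, w j := fun Z =>
    Finset.sum_nonneg fun j _ => (hw0 j).le
  refine (sum_not_disjoint_le X fun Z => mul_nonneg (hh Z)
    (add_nonneg (by split_ifs <;> simp) (mul_nonneg (hsum0 Z) hg))).trans ?_
  rw [Finset.mul_sum, Finset.sum_mul]
  refine Finset.sum_le_sum fun i _ => ?_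
  have key : ∀ Z ∈ Finset.univ.filter (fun Z : Finset Λ => i ∈ Z),
      h Z * ((if Disjoint Z Y then 0 else 1) + (∑ j ∈ Z, w j) * g) ≤
        h Z * (Z.card : ℝ) * Real.exp (μ * Metric.diam (Z : Set Λ)) * (w i * (1 + g)) := by
    intro Z hZ
    have hi : i ∈ Z := (Finset.mem_filter.1 hZ).2
    set E := Real.exp (μ * Metric.diam (Z : Set Λ)) with hE
    have hj : ∀ j ∈ Z, w j ≤ E * w i := fun j hj => (hw i j).trans <|
      mul_le_mul_of_nonneg_right (Real.exp_le_exp.2 <| mul_le_mul_of_nonneg_left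
        (Metric.dist_le_diam_of_mem Z.finite_toSet.isBounded hi hj) hμ) (hw0 i).le
    have hEw : 0 ≤ E * w i := mul_nonneg (Real.exp_nonneg _) (hw0 i).le
    have hcard : (1 : ℝ) ≤ Z.card := by
      exact_mod_cast Finset.card_pos.2 ⟨i, hi⟩
    -- The factor `Z.card` is needed only for `h2`; it is spent here too so that both terms share
    -- one bound.
    have h1 : (if Disjoint Z Y then (0 : ℝ) else 1) ≤ Z.card * (E * w i) := by
      split_ifs with hd
      · positivity
      · obtain ⟨j, hjZ, hjY⟩ := Finset.not_disjoint_iff.1 hd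
        calc (1 : ℝ) ≤ E * w i := (hwY j hjY).trans (hj j hjZ)
          _ ≤ Z.card * (E * w i) := le_mul_of_one_le_left hEw hcard
    have h2 : ∑ j ∈ Z, w j ≤ Z.card * (E * w i) := by
      simpa using Finset.sum_le_card_nsmul Z w _ hj
    calc h Z * ((if Disjoint Z Y then 0 else 1) + (∑ j ∈ Z, w j) * g)
        ≤ h Z * (Z.card * (E * w i) + Z.card * (E * w i) * g) :=
          mul_le_mul_of_nonneg_left (add_le_add h1 (mul_le_mul_of_nonneg_right h2 hg)) (hh Z)
      _ = h Z * (Z.card : ℝ) * E * (w i * (1 + g)) := by ring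
  refine (Finset.sum_le_sum key).trans ?_
  rw [← Finset.sum_mul, mul_assoc s]
  exact mul_le_mul_of_nonneg_right (hdecay i) (mul_nonneg (hw0 i).le (by linarith))

end Combinatorics

/-! ### The iterated commutator bound and its limit. -/

section Iteration

variable {Λ : Type*} [Fintype Λ] [DecidableEq Λ] {D : ℕ}

theorem heisenberg_eq_evolve (H O : Op Λ D) (t : ℝ) : heisenberg H t O = evolve H t O := by
  simp [heisenberg, evolve, unitaryFlow]

theorem heisenberg_neg (H O : Op Λ D) (t : ℝ) : heisenberg (-H) t O = heisenberg H (-t) O := by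
  simp [heisenberg]

variable [PseudoMetricSpace Λ]

/-- The bound is uniform over all `X` and `A`, so that the induction can pass to the interaction
terms. The indicator is needed since these may meet `Y` even when the original `X` does not. -/
theorem norm_commutator_evolve_le_picardIterate {HZ : Finset Λ → Op Λ D}
    (hsupp : ∀ Z, IsSupportedOn (HZ Z) Z) (hherm : ∀ Z, IsSelfAdjoint (HZ Z))
    {μ s : ℝ} (hμ : 0 ≤ μ) (hs : 0 ≤ s)
    (hdecay : ∀ i : Λ, ∑ Z : Finset Λ with i ∈ Z,
      ‖HZ Z‖ * (Z.card : ℝ) * Real.exp (μ * Metric.diam (Z : Set Λ)) ≤ s)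
    {w : Λ → ℝ} (hw0 : ∀ i, 0 < w i) (hw : ∀ i j, w j ≤ Real.exp (μ * dist i j) * w i)
    {Y : Finset Λ} (hwY : ∀ j ∈ Y, 1 ≤ w j) {c : ℝ} (hc : ∀ i, 1 ≤ w i * c)
    {B : Op Λ D} (hB : IsSupportedOn B Y) (n : ℕ) :
    ∀ (X : Finset Λ) (_ : X.Nonempty) (A : Op Λ D) (_ : IsSupportedOn A X) (t : ℝ) (_ : 0 ≤ t),
      ‖⁅evolve (hamiltonian HZ) t A, B⁆‖ ≤ 2 * ‖A‖ * ‖B‖ *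
        ((if Disjoint X Y then 0 else 1) + (∑ i ∈ X, w i) * picardIterate c s n t) := by
  have hH : IsSelfAdjoint (hamiltonian HZ) := isSelfAdjoint_sum _ fun Z _ => hherm Z
  induction n with
  | zero =>
    intro X hX A _ t _
    -- The base case is the trivial commutator bound, since `c` makes the weight factor at least
    -- `1`.
    refine (norm_commutator_le _ _).trans ?_
    rw [norm_evolve hH]
    refine le_mul_of_one_le_right (by positivity) ?_
    obtain ⟨i, hi⟩ := hX
    have hc0 : 0 ≤ c := (pos_of_mul_pos_right (zero_lt_one.trans_le (hc i)) (hw0 i).le).le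
    have h1 : w i ≤ ∑ i ∈ X, w i := Finset.single_le_sum (fun j _ => (hw0 j).le) hi
    have h2 : 1 ≤ (∑ i ∈ X, w i) * c := (hc i).trans (mul_le_mul_of_nonneg_right h1 hc0)
    have h3 : picardIterate c s 0 t = c := by simp [picardIterate]
    rw [h3]
    split_ifs <;> linarith
  | succ n ih =>
    intro X hX A hA t ht
    obtain ⟨i₀, hi₀⟩ := hX
    have hc0 : 0 ≤ c := (pos_of_mul_pos_right (zero_lt_one.trans_le (hc i₀)) (hw0 i₀).le).le
    let K : Op Λ D := ∑ Z : Finset Λ with Disjoint X Z, HZ Z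
    have hsub : hamiltonian HZ - K = ∑ Z : Finset Λ with ¬ Disjoint X Z, HZ Z :=
      sub_eq_of_eq_add' (Finset.sum_filter_add_sum_filter_not _ _ _).symm
    have hK : IsSelfAdjoint K := isSelfAdjoint_sum _ fun Z _ => hherm Z
    have hAK : Commute A K := Commute.sum_right _ _ _ fun Z hZ =>
      hA.commute (hsupp Z) (Finset.mem_filter.1 hZ).2
    refine norm_commutator_evolve_le hH hK hAK (β := fun t => 2 * ‖A‖ * ‖B‖ *
        ((if Disjoint X Y then 0 else 1) + (∑ i ∈ X, w i) * picardIterate c s (n + 1) t))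
      (fun t => (((hasDerivAt_picardIterate_succ c s n t).const_mul _).const_add _).const_mul _)
      ?_ (fun u hu => ?_) ht
    -- At time zero, operators with disjoint supports commute.
    · simp only [picardIterate_succ_zero, mul_zero, add_zero]
      split_ifs with hd
      · rw [Ring.lie_def, (hA.commute hB hd).eq, sub_self, norm_zero, mul_zero]
      · rw [mul_one]
        exact norm_commutator_le A B
    · have hg := picardIterate_nonneg hc0 hs hu n
      have hterm : ∀ Z ∈ Finset.univ.filter (fun Z : Finset Λ => ¬ Disjoint X Z),
          ‖⁅evolve (hamiltonian HZ) u (HZ Z), B⁆‖ ≤ 2 * ‖B‖ * (‖HZ Z‖ *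
            ((if Disjoint Z Y then 0 else 1) + (∑ i ∈ Z, w i) * picardIterate c s n u)) := by
        intro Z hZ
        -- The induction hypothesis needs `Z` nonempty; the term of the empty set lies in `K`.
        obtain ⟨i, -, hi⟩ := Finset.not_disjoint_iff.1 (Finset.mem_filter.1 hZ).2
        refine (ih Z ⟨i, hi⟩ (HZ Z) (hsupp Z) u hu).trans (le_of_eq ?_)
        ring
      have hI : ‖⁅evolve (hamiltonian HZ) u (hamiltonian HZ - K), B⁆‖ ≤
          2 * ‖B‖ * (s * (∑ i ∈ X, w i) * (1 + picardIterate c s n u)) := by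
        have hsplit : ⁅evolve (hamiltonian HZ) u (hamiltonian HZ - K), B⁆ =
            ∑ Z : Finset Λ with ¬ Disjoint X Z, ⁅evolve (hamiltonian HZ) u (HZ Z), B⁆ := by
          rw [hsub, evolve_sum, Ring.lie_def, Finset.sum_mul, Finset.mul_sum,
            ← Finset.sum_sub_distrib]
          rfl
        rw [hsplit]
        refine (norm_sum_le_of_le _ hterm).trans ?_
        rw [← Finset.mul_sum]
        exact mul_le_mul_of_nonneg_left (sum_not_disjoint_weight_le (fun Z => norm_nonneg _) hμ
          hdecay hw0 hw hwY hg X) (by positivity)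
      calc 2 * ‖A‖ * ‖⁅evolve (hamiltonian HZ) u (hamiltonian HZ - K), B⁆‖
          ≤ 2 * ‖A‖ * (2 * ‖B‖ * (s * (∑ i ∈ X, w i) * (1 + picardIterate c s n u))) :=
            mul_le_mul_of_nonneg_left hI (by positivity)
        _ = _ := by ring

/-- Lieb–Robinson bound for Hermitian interaction terms, nonnegative times and general weights. -/
theorem norm_commutator_evolve_le_exp {HZ : Finset Λ → Op Λ D}
    (hsupp : ∀ Z, IsSupportedOn (HZ Z) Z) (hherm : ∀ Z, IsSelfAdjoint (HZ Z))
    {μ s : ℝ} (hμ : 0 ≤ μ) (hs : 0 ≤ s)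
    (hdecay : ∀ i : Λ, ∑ Z : Finset Λ with i ∈ Z,
      ‖HZ Z‖ * (Z.card : ℝ) * Real.exp (μ * Metric.diam (Z : Set Λ)) ≤ s)
    {w : Λ → ℝ} (hw0 : ∀ i, 0 < w i) (hw : ∀ i j, w j ≤ Real.exp (μ * dist i j) * w i)
    {X Y : Finset Λ} (hwY : ∀ j ∈ Y, 1 ≤ w j) (hX : X.Nonempty) (hXY : Disjoint X Y)
    {A B : Op Λ D} (hA : IsSupportedOn A X) (hB : IsSupportedOn B Y) {t : ℝ} (ht : 0 ≤ t) :
    ‖⁅evolve (hamiltonian HZ) t A, B⁆‖ ≤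
      2 * ‖A‖ * ‖B‖ * (∑ i ∈ X, w i) * (Real.exp (2 * s * t) - 1) := by
  -- Any `c` with `1 ≤ w i * c` would do: its contribution vanishes as `n` grows.
  let c : ℝ := ∑ i, (w i)⁻¹
  have hc : ∀ i, 1 ≤ w i * c := fun i => by
    rw [← mul_inv_cancel₀ (hw0 i).ne']
    exact mul_le_mul_of_nonneg_left (Finset.single_le_sum (f := fun i => (w i)⁻¹)
      (fun j _ => (inv_pos.2 (hw0 j)).le) (Finset.mem_univ i)) (hw0 i).le
  have hlim : Filter.Tendsto (fun n : ℕ => 2 * ‖A‖ * ‖B‖ * (∑ i ∈ X, w i) *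
      (Real.exp (2 * s * t) - 1 + c * ((2 * s * t) ^ n / n.factorial))) Filter.atTop
      (nhds (2 * ‖A‖ * ‖B‖ * (∑ i ∈ X, w i) * (Real.exp (2 * s * t) - 1 + c * 0))) :=
    (((FloorSemiring.tendsto_pow_div_factorial_atTop (2 * s * t)).const_mul c).const_add
      _).const_mul _
  rw [mul_zero, add_zero] at hlim
  refine ge_of_tendsto' hlim fun n => ?_
  have h := norm_commutator_evolve_le_picardIterate hsupp hherm hμ hs hdecay hw0 hw hwY hc hB n
    X hX A hA t ht
  rw [if_pos hXY, zero_add, ← mul_assoc] at h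
  exact h.trans (mul_le_mul_of_nonneg_left (picardIterate_le hs ht n)
    (mul_nonneg (by positivity) (Finset.sum_nonneg fun i _ => (hw0 i).le)))

end Iteration

/-! ### Reduction to Hermitian interaction terms. -/

section Symmetrization

variable {Λ : Type*} [Fintype Λ] [DecidableEq Λ] {D : ℕ}

/-- The Hermitian part of an operator. -/
noncomputable def hermitianPart (O : Op Λ D) : Op Λ D := (1 / 2 : ℂ) • (O + O.conjTranspose)

theorem IsSupportedOn.hermitianPart {O : Op Λ D} {A : Finset Λ} (h : IsSupportedOn O A) :
    IsSupportedOn (hermitianPart O) A :=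
  (h.add h.conjTranspose).smul _

theorem isSelfAdjoint_hermitianPart (O : Op Λ D) : IsSelfAdjoint (hermitianPart O) := by
  rw [IsSelfAdjoint, hermitianPart, star_smul, star_add, Matrix.star_eq_conjTranspose,
    Matrix.star_eq_conjTranspose, Matrix.conjTranspose_conjTranspose, add_comm]
  simp

theorem norm_hermitianPart_le (O : Op Λ D) : ‖hermitianPart O‖ ≤ ‖O‖ := by
  have h := norm_add_le O O.conjTranspose
  rw [Matrix.l2_opNorm_conjTranspose] at h
  rw [hermitianPart, norm_smul]
  norm_num
  linarith

end Symmetrization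

theorem hamiltonian_hermitianPart {Λ : Type*} [Fintype Λ] {D : ℕ} {HZ : Finset Λ → Op Λ D}
    (h : (hamiltonian HZ).IsHermitian) :
    hamiltonian (fun Z => hermitianPart (HZ Z)) = hamiltonian HZ := by
  have e : (∑ Z, (HZ Z).conjTranspose) = ∑ Z, HZ Z := by
    rw [← Matrix.conjTranspose_sum]; exact h
  simp only [hamiltonian, hermitianPart]
  rw [← Finset.smul_sum, Finset.sum_add_distrib, e, ← two_smul ℂ, smul_smul]
  norm_num


/-! ### Distances between sets of sites. -/

section Distance

variable {Λ : Type*} [PseudoMetricSpace Λ]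

theorem setDist_le_dist {A B : Finset Λ} (hA : A.Nonempty) (hB : B.Nonempty) {i j : Λ}
    (hi : i ∈ A) (hj : j ∈ B) : setDist A B hA hB ≤ dist i j :=
  Finset.inf'_le (fun p : Λ × Λ => dist p.1 p.2) (Finset.mk_mem_product hi hj)

theorem le_setDist {A B : Finset Λ} (hA : A.Nonempty) (hB : B.Nonempty) {r : ℝ}
    (h : ∀ i ∈ A, ∀ j ∈ B, r ≤ dist i j) : r ≤ setDist A B hA hB :=
  Finset.le_inf' _ _ fun p hp => h p.1 (Finset.mem_product.1 hp).1 p.2 (Finset.mem_product.1 hp).2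

theorem setDist_singleton_le_add {B : Finset Λ} (hB : B.Nonempty) (i j : Λ) :
    setDist {i} B (Finset.singleton_nonempty i) hB ≤
      dist i j + setDist {j} B (Finset.singleton_nonempty j) hB := by
  rw [← sub_le_iff_le_add']
  refine le_setDist _ hB fun j' hj' k hk => ?_
  rw [Finset.mem_singleton] at hj'
  subst hj'
  have h := setDist_le_dist (Finset.singleton_nonempty i) hB (Finset.mem_singleton_self i) hk
  linarith [dist_triangle i j' k]

theorem disjoint_of_setDist_pos {A B : Finset Λ} {hA : A.Nonempty} {hB : B.Nonempty}
    (h : 0 < setDist A B hA hB) : Disjoint A B :=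
  Finset.disjoint_left.2 fun i hi hi' =>
    absurd (setDist_le_dist hA hB hi hi') (by rw [dist_self]; exact not_le.2 h)

end Distance

theorem norm_commutator_heisenberg_le {Λ : Type*} [Fintype Λ] [DecidableEq Λ]
    [PseudoMetricSpace Λ] {D : ℕ} {HZ : Finset Λ → Op Λ D}
    (hsupp : ∀ Z, IsSupportedOn (HZ Z) Z) (hherm : (hamiltonian HZ).IsHermitian)
    {μ s : ℝ} (hμ : 0 ≤ μ) (hs : 0 ≤ s)
    (hdecay : ∀ i : Λ, ∑ Z : Finset Λ with i ∈ Z,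
      ‖HZ Z‖ * (Z.card : ℝ) * Real.exp (μ * Metric.diam (Z : Set Λ)) ≤ s)
    {X Y : Finset Λ} (hX : X.Nonempty) (hY : Y.Nonempty) (hXY : Disjoint X Y)
    {A B : Op Λ D} (hA : IsSupportedOn A X) (hB : IsSupportedOn B Y) {t : ℝ} (ht : 0 ≤ t) :
    ‖⁅heisenberg (hamiltonian HZ) t A, B⁆‖ ≤ 2 * ‖A‖ * ‖B‖ *
      (∑ i ∈ X, Real.exp (-μ * setDist {i} Y (Finset.singleton_nonempty i) hY)) *
        (Real.exp (2 * s * t) - 1) := by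
  rw [heisenberg_eq_evolve, ← hamiltonian_hermitianPart hherm]
  -- Unification with the goal fixes the weight as `exp(-μ dist(i, Y))`.
  refine norm_commutator_evolve_le_exp (fun Z => (hsupp Z).hermitianPart)
    (fun Z => isSelfAdjoint_hermitianPart _) hμ hs (fun i => ?_) (fun i => Real.exp_pos _)
    (fun i j => ?_) (fun j hj => ?_) hX hXY hA hB ht
  · refine le_trans (Finset.sum_le_sum fun Z _ => ?_) (hdecay i)
    gcongr
    exact norm_hermitianPart_le _
  · rw [← Real.exp_add, Real.exp_le_exp]
    have h := mul_le_mul_of_nonneg_left (setDist_singleton_le_add hY i j) hμ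
    linarith
  · rw [Real.one_le_exp_iff]
    have h := setDist_le_dist (Finset.singleton_nonempty j) hY (Finset.mem_singleton_self j) hj
    rw [dist_self] at h
    have h' := mul_le_mul_of_nonneg_left h hμ
    linarith

end LiebRobinson

theorem theorem1 {Λ : Type*} [Fintype Λ] [DecidableEq Λ] [PseudoMetricSpace Λ] (D : ℕ)
    (HZ : Finset Λ → LiebRobinson.Op Λ D)
    (hsupp : ∀ Z : Finset Λ, LiebRobinson.IsSupportedOn (HZ Z) Z)
    (hherm : (LiebRobinson.hamiltonian HZ).IsHermitian)
    (μ s : ℝ) (hμ : 0 < μ) (hs : 0 < s)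
    (hdecay : ∀ i : Λ, ∑ Z : Finset Λ with i ∈ Z,
      ‖HZ Z‖ * (Z.card : ℝ) * Real.exp (μ * Metric.diam (Z : Set Λ)) ≤ s)
    (X Y : Finset Λ) (hX : X.Nonempty) (hY : Y.Nonempty)
    (A B : LiebRobinson.Op Λ D)
    (hA : LiebRobinson.IsSupportedOn A X) (hB : LiebRobinson.IsSupportedOn B Y)
    (hXY : 0 < LiebRobinson.setDist X Y hX hY) (t : ℝ) :
    ‖⁅LiebRobinson.heisenberg (LiebRobinson.hamiltonian HZ) t A, B⁆‖
        ≤ 2 * ‖A‖ * ‖B‖ *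
          (∑ i ∈ X, Real.exp (-μ * LiebRobinson.setDist {i} Y (Finset.singleton_nonempty i) hY)) *
          (Real.exp (2 * s * |t|) - 1) ∧
      2 * ‖A‖ * ‖B‖ *
          (∑ i ∈ X, Real.exp (-μ * LiebRobinson.setDist {i} Y (Finset.singleton_nonempty i) hY)) *
          (Real.exp (2 * s * |t|) - 1)
        ≤ 2 * ‖A‖ * ‖B‖ * (X.card : ℝ) * Real.exp (-μ * LiebRobinson.setDist X Y hX hY) *
          (Real.exp (2 * s * |t|) - 1) := by
  refine ⟨?_, ?_⟩
  · have hd := LiebRobinson.disjoint_of_setDist_pos hXY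
    rcases le_total 0 t with ht | ht
    · rw [abs_of_nonneg ht]
      exact LiebRobinson.norm_commutator_heisenberg_le hsupp hherm hμ.le hs.le hdecay hX hY hd hA hB
        ht
    · rw [abs_of_nonpos ht]
      -- Negative time is positive time for `-H`, whose terms have the same supports and norms.
      have hneg : LiebRobinson.hamiltonian (fun Z => -HZ Z) = -LiebRobinson.hamiltonian HZ :=
        Finset.sum_neg_distrib _
      have h := LiebRobinson.norm_commutator_heisenberg_le (HZ := fun Z => -HZ Z)
        (fun Z => by simpa using (hsupp Z).smul (-1)) (by rw [hneg]; exact hherm.neg) hμ.le hs.le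
        (by simpa only [norm_neg] using hdecay) hX hY hd hA hB (neg_nonneg.2 ht)
      rwa [hneg, LiebRobinson.heisenberg_neg, neg_neg] at h
  · have hexp : 0 ≤ Real.exp (2 * s * |t|) - 1 :=
      sub_nonneg.2 (Real.one_le_exp (by positivity))
    refine mul_le_mul_of_nonneg_right ?_ hexp
    rw [mul_assoc (2 * ‖A‖ * ‖B‖)]
    refine mul_le_mul_of_nonneg_left ?_ (by positivity)
    rw [← nsmul_eq_mul]
    refine Finset.sum_le_card_nsmul _ _ _ fun i hi => Real.exp_le_exp.2 ?_
    refine mul_le_mul_of_nonpos_left ?_ (neg_nonpos.2 hμ.le)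
    refine LiebRobinson.le_setDist _ hY fun i' hi' j hj => ?_
    rw [Finset.mem_singleton] at hi'
    subst hi'
    exact LiebRobinson.setDist_le_dist hX hY hi hj
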